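/- Let $H_1,H_2$ be real Hilbert spaces, let $B_1:H_1\to 2^{H_1}$ and $B_2:H_2\to 2^{H_2}$ be maximal monotone set-valued operators, let $A:H_1\to H_2$ be a bounded linear operator with adjoint $A^*$, and let $f_1:H_1\to H_1$ and $f_2:H_2\to H_2$ be $\tau_1$- and $\tau_2$-inverse strongly monotone, respectively; that is, $\tau_i>0$ and $$\langle f_i(x)-f_i(y),x-y\rangle\ge\tau_i\|f_i(x)-f_i(y)\|^2\quad\text{for all }x,y\in H_i .$$ Let $F:H_1\to H_1$ be Lipschitz continuous and $\gamma$-strongly monotone; that is, $\gamma>0$ and $\langle F(x)-F(y),x-y\rangle\ge\gamma\|x-y\|^2$ for all $x,y\in H_1$. Let $$\Omega=\{x\in H_1:\ 0\in B_1(x)+f_1(x)\ \text{ and }\ 0\in B_2(Ax)+f_2(Ax)\}$$ and assume that $\Omega\neq\emptyset$. For a maximal monotone operator $B$ and $\lambda>0$ let $J_\lambda^{B}=(I+\lambda B)^{-1}$ denote the (single-valued, everywhere defined) resolvent. Let $(\alpha_n)_{n\ge1}$ and $(\lambda_n)_{n\ge1}$ be sequences of real numbers such that 1. $\alpha_n\in(0,1)$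 for all $n\ge1$, $\lim_{n\to\infty}\alpha_n=0$ and $\sum_{n=1}^\infty\alpha_n=\infty$; 2. $\lim_{n\to\infty}|\alpha_{n+1}-\alpha_n|/\alpha_n^2=0$; 3. there are constants $c>0$ and $\rho>2$ with $c<\lambda_n<\frac1\rho\min\{\tilde\tau,\,1/\|A\|^2\}$ for all $n\ge1$, where $\tilde\tau=\min\{\tau_1,\tau_2\}$ and $1/\|A\|^2$ is read as $+\infty$ if $A=0$. Let $z_1\in H_1$ be arbitrary and define, for $n\ge1$, $$z_{n+1}=J_{\lambda_n}^{B_1}\Big(z_n-\lambda_n f_1(z_n)-\lambda_n A^*\big(I-J_{\lambda_n}^{B_2}(I-\lambda_n f_2)\big)A z_n-\lambda_n\alpha_n F(z_n)\Big).$$ Then there is exactly one $u\in\Omega$ such that $\langle F(u),x-u\rangle\ge0$ for all $x\in\Omega$, and the sequence $(z_n)$ converges strongly (in norm) to this $u$. -/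

import Mathlib

open Filter Topology
open scoped NNReal

namespace SplitInclusion

section Operators

variable {H : Type*} [NormedAddCommGroup H] [InnerProductSpace ℝ H]

/-- The graph of a set-valued operator. -/
def graph (B : H → Set H) : Set (H × H) := {p | p.2 ∈ B p.1}

/-- Monotone set-valued operators. -/
def IsMonotone (B : H → Set H) : Prop :=
  ∀ x y : H, ∀ u ∈ B x, ∀ v ∈ B y, 0 ≤ inner ℝ (u - v) (x - y)

/-- Maximal monotone set-valued operators: monotone, and the graph is not strictly contained in the
graph of another monotone operator. -/
def IsMaximalMonotone (B : H → Set H) : Prop :=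
  IsMonotone B ∧ ∀ C : H → Set H, IsMonotone C → ¬ graph B ⊂ graph C

/-- `f` is `τ`-inverse strongly monotone. -/
def IsInverseStronglyMonotone (τ : ℝ) (f : H → H) : Prop :=
  0 < τ ∧ ∀ x y : H, τ * ‖f x - f y‖ ^ 2 ≤ inner ℝ (f x - f y) (x - y)

/-- `F` is `γ`-strongly monotone. -/
def IsStronglyMonotone (γ : ℝ) (F : H → H) : Prop :=
  0 < γ ∧ ∀ x y : H, γ * ‖x - y‖ ^ 2 ≤ inner ℝ (F x - F y) (x - y)

/-- The set-valued inverse `(I + lam B)⁻¹`, evaluated at `x`. -/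
def resolventValues (B : H → Set H) (lam : ℝ) (x : H) : Set H :=
  {y | ∃ b ∈ B y, y + lam • b = x}

/-- For a monotone operator and `lam > 0` the set-valued inverse `(I + lam B)⁻¹` is at most
single-valued. -/
theorem resolventValues_subsingleton {B : H → Set H} (hB : IsMonotone B) {lam : ℝ} (hl : 0 < lam)
    (x : H) : (resolventValues B lam x).Subsingleton := by
  rintro y ⟨b, hb, hyx⟩ y' ⟨b', hb', hyx'⟩
  have h := hB y y' b hb b' hb'
  have e : y - y' = -(lam • (b - b')) := by
    rw [smul_sub]
    have h0 : y + lam • b - (y' + lam • b') = 0 := by rw [hyx, hyx', sub_self]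
    rw [← sub_eq_zero]
    rw [← h0]
    abel
  rw [e, inner_neg_right, inner_smul_right, real_inner_self_eq_norm_sq] at h
  have h1 : ‖b - b'‖ ^ 2 = 0 := by
    have h2 : 0 ≤ ‖b - b'‖ ^ 2 := sq_nonneg _
    nlinarith
  have h3 : b - b' = 0 := by simpa using h1
  rw [h3, smul_zero, neg_zero] at e
  exact sub_eq_zero.mp e

/-- The resolvent `J = (I + lam B)⁻¹` as a single-valued mapping: its value at `x` is the element of
`(I + lam B)⁻¹ x`. (For `B` maximal monotone on a Hilbert space and `lam > 0`, that set has exactly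
one element; where it is empty, the value is arbitrary.) -/
noncomputable def resolventMap (B : H → Set H) (lam : ℝ) (x : H) : H :=
  Classical.epsilon fun y => y ∈ resolventValues B lam x

/-- The solutions of the inclusion `0 ∈ B x + f x`. -/
def inclusionSolutions (B : H → Set H) (f : H → H) : Set H :=
  {x | ∃ b ∈ B x, b + f x = 0}

/-- `u` solves the variational inequality `⟨F u, x - u⟩ ≥ 0` for all `x ∈ C`, with `u ∈ C`. -/
def SolvesVI (F : H → H) (C : Set H) (u : H) : Prop :=
  u ∈ C ∧ ∀ x ∈ C, 0 ≤ inner ℝ (F u) (x - u)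

end Operators

section Split

variable {H₁ H₂ : Type*} [NormedAddCommGroup H₁] [InnerProductSpace ℝ H₁]
  [NormedAddCommGroup H₂] [InnerProductSpace ℝ H₂]

/-- The solution set of the split variational inclusion problem. -/
def solutionSet (B₁ : H₁ → Set H₁) (B₂ : H₂ → Set H₂) (f₁ : H₁ → H₁) (f₂ : H₂ → H₂)
    (A : H₁ →L[ℝ] H₂) : Set H₁ :=
  {x | x ∈ inclusionSolutions B₁ f₁ ∧ A x ∈ inclusionSolutions B₂ f₂}

open Classical in
/-- `min {τ, 1 / ‖A‖²}`, where `1 / ‖A‖² = +∞` for `A = 0`. -/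
noncomputable def stepBound (τ : ℝ) (A : H₁ →L[ℝ] H₂) : ℝ :=
  if A = 0 then τ else min τ (1 / ‖A‖ ^ 2)

/-- The mapping `T = J_lam (I - lam f)` for an operator `B` and a mapping `f`. -/
noncomputable def forwardBackward (B : H₂ → Set H₂) (f : H₂ → H₂) (lam : ℝ) (y : H₂) : H₂ :=
  resolventMap B lam (y - lam • f y)

/-- One step of the regularized forward-backward iteration with step size `lam` and regularization
parameter `a`. -/
noncomputable def step [CompleteSpace H₁] [CompleteSpace H₂]
    (B₁ : H₁ → Set H₁) (B₂ : H₂ → Set H₂) (f₁ : H₁ → H₁) (f₂ : H₂ → H₂)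
    (A : H₁ →L[ℝ] H₂) (F : H₁ → H₁) (lam a : ℝ) (z : H₁) : H₁ :=
  resolventMap B₁ lam
    (z - lam • f₁ z
      - lam • ContinuousLinearMap.adjoint A (A z - forwardBackward B₂ f₂ lam (A z))
      - (lam * a) • F z)

end Split

end SplitInclusion

/-!
The solution set `Ω` is an intersection of closed half-spaces (`inclusionSolutions_eq_iInter`), so
the variational inequality for the strongly monotone Lipschitz map `F` has exactly one solution `u`
in it: it is the fixed point of `x ↦ P (x - μ F x)`, with `P` the projection onto `Ω`
(`exists_solvesVI`, `SolvesVI.eq`).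

Write `s n = ‖z n - u‖²`. Firm nonexpansiveness of the resolvents and inverse strong monotonicity of
`f₁`, `f₂` give the energy inequality (`norm_step_sub_sq_le`)
`s (n + 1) ≤ s n - k * defect n + α n * h n`, where the defect is the sum of the squares of all the
quantities that vanish at a solution, and `h n = -2 λ n ⟪F (z n), z n - u⟫ + O(α n ‖F (z n)‖²)`.
Strong monotonicity of `F` turns it into a bound on `s` (`exists_bound_of_descent`).

Convergence then follows from a statement on real sequences (`tendsto_zero_of_descent`): since
`∑ α n = ∞`, it is enough that `h` is eventually below a negative constant along every ultrafilter
along which `s` stays away from zero and the defect vanishes. Along such an ultrafilter `z` has a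
weak limit `w`, and `w ∈ Ω` because the graph of a maximal monotone operator is weakly-strongly
closed (`mem_solutionSet_of_weakTendsto`). Hence `⟪F u, z n - u⟫ → ⟪F u, w - u⟫ ≥ 0`, and strong
monotonicity of `F` makes `h` negative.

That the resolvents are defined everywhere is Minty's theorem
(`IsMaximalMonotone.resolventValues_nonempty`). It is obtained from Kirszbraun's intersection
property of balls: a maximizer of a concave dual function on the simplex yields a common point of
finitely many balls, and weak compactness extends this to infinitely many.
-/

namespace SplitInclusion

/-! ### Weak limits along ultrafilters -/

section Weak

variable {H : Type*} [NormedAddCommGroup H] [InnerProductSpace ℝ H] {ι : Type*}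

/-- Weak convergence of a family in a Hilbert space along a filter, tested against the functionals
`⟪·, y⟫`. -/
def WeakTendsto (x : ι → H) (l : Filter ι) (w : H) : Prop :=
  ∀ y : H, Tendsto (fun i => inner ℝ (x i) y) l (𝓝 (inner ℝ w y))

/-- A family that is bounded along an ultrafilter converges weakly along it (Banach–Alaoglu and the
Riesz representation). -/
theorem exists_weakTendsto [CompleteSpace H] (U : Ultrafilter ι) {x : ι → H} {C : ℝ}
    (hx : ∀ᶠ i in (U : Filter ι), ‖x i‖ ≤ C) : ∃ w, WeakTendsto x U w := by
  have hK := WeakDual.isCompact_closedBall (0 : StrongDual ℝ H) C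
  obtain ⟨φ, -, hφ⟩ := isCompact_iff_ultrafilter_le_nhds.1 hK
    (U.map fun i => StrongDual.toWeakDual (InnerProductSpace.toDual ℝ H (x i))) (by
      rw [le_principal_iff, Ultrafilter.coe_map, mem_map]
      filter_upwards [hx] with i hi
      simpa using hi)
  refine ⟨(InnerProductSpace.toDual ℝ H).symm (WeakDual.toStrongDual φ), fun y => ?_⟩
  have h := ((WeakDual.eval_continuous (𝕜 := ℝ) y).tendsto φ).comp hφ
  rw [← InnerProductSpace.toDual_apply_apply, LinearIsometryEquiv.apply_symm_apply]
  exact h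

theorem WeakTendsto.add_of_tendsto_sub {l : Filter ι} {x y : ι → H} {w : H}
    (hx : WeakTendsto x l w) (h : Tendsto (fun i => y i - x i) l (𝓝 0)) : WeakTendsto y l w := by
  intro v
  have h1 := (hx v).add (h.inner (tendsto_const_nhds (x := v)))
  simpa [inner_sub_left] using h1

theorem WeakTendsto.map {l : Filter ι} {x : ι → H} {w : H} {H' : Type*} [NormedAddCommGroup H']
    [InnerProductSpace ℝ H'] [CompleteSpace H] [CompleteSpace H']
    (hx : WeakTendsto x l w) (A : H →L[ℝ] H') : WeakTendsto (fun i => A (x i)) l (A w) := by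
  intro v
  simpa only [← ContinuousLinearMap.adjoint_inner_right] using hx (ContinuousLinearMap.adjoint A v)

/-- The inner product of a bounded weakly convergent family with a norm convergent one converges. -/
theorem WeakTendsto.inner_tendsto {l : Filter ι} {x y : ι → H} {w v : H} {C : ℝ}
    (hx : WeakTendsto x l w) (hC : ∀ᶠ i in l, ‖x i‖ ≤ C) (hy : Tendsto y l (𝓝 v)) :
    Tendsto (fun i => inner ℝ (x i) (y i)) l (𝓝 (inner ℝ w v)) := by
  have h0 : Tendsto (fun i => inner ℝ (x i) (y i - v)) l (𝓝 0) := by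
    have hy' : Tendsto (fun i => C * ‖y i - v‖) l (𝓝 0) := by
      simpa using (tendsto_iff_norm_sub_tendsto_zero.1 hy).const_mul C
    refine squeeze_zero_norm' ?_ hy'
    filter_upwards [hC] with i hi
    exact (norm_inner_le_norm _ _).trans (by gcongr)
  simpa [inner_sub_right] using h0.add (hx v)

end Weak

/-! ### Intersections of balls and Minty's theorem -/

section Kirszbraun

variable {H : Type*} [NormedAddCommGroup H] [InnerProductSpace ℝ H] {ι : Type*}

theorem sum_sum_mul_norm_sub_sq [Fintype ι] (l : ι → ℝ) (hl : ∑ i, l i = 1) (c : ι → H) :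
    ∑ i, ∑ j, l i * l j * ‖c i - c j‖ ^ 2
      = 2 * (∑ i, l i * ‖c i‖ ^ 2 - ‖∑ i, l i • c i‖ ^ 2) := by
  have h1 : ∀ i j, l i * l j * ‖c i - c j‖ ^ 2 = l j * (l i * ‖c i‖ ^ 2) + l i * (l j * ‖c j‖ ^ 2)
      - 2 * inner ℝ (l i • c i) (l j • c j) := by
    intro i j
    rw [norm_sub_sq_real, real_inner_smul_left, real_inner_smul_right]
    ring
  simp only [h1, Finset.sum_sub_distrib, Finset.sum_add_distrib, ← Finset.mul_sum,
    ← Finset.sum_mul, ← inner_sum, ← sum_inner, hl, real_inner_self_eq_norm_sq]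
  ring

/-- Finite Kirszbraun theorem: balls whose centres are at most as far apart as the vectors that
give their radii have a common point. The common point is `∑ i, l i • c i`, where `l` maximizes the
concave dual function of the minimax problem `min_z max_i (‖z - c i‖² - ‖R i‖²)` over the
simplex. -/
theorem exists_forall_norm_sub_le_of_fintype [Fintype ι] [Nonempty ι] (c R : ι → H)
    (h : ∀ i j, ‖c i - c j‖ ≤ ‖R i - R j‖) : ∃ z, ∀ i, ‖z - c i‖ ≤ ‖R i‖ := by
  classical
  let d : (ι → ℝ) → ℝ := fun l =>
    ∑ i, l i * (‖c i‖ ^ 2 - ‖R i‖ ^ 2) - ‖∑ i, l i • c i‖ ^ 2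
  have hd : Continuous d := by fun_prop
  obtain ⟨l, hl, hmax⟩ := (isCompact_stdSimplex ℝ ι).exists_isMaxOn
    ⟨_, single_mem_stdSimplex ℝ (Classical.arbitrary ι)⟩ hd.continuousOn
  have hd0 : d l ≤ 0 := by
    have hc := sum_sum_mul_norm_sub_sq l hl.2 c
    have hR := sum_sum_mul_norm_sub_sq l hl.2 R
    have hle : ∑ i, ∑ j, l i * l j * ‖c i - c j‖ ^ 2 ≤ ∑ i, ∑ j, l i * l j * ‖R i - R j‖ ^ 2 := by
      gcongr with i _ j _
      · exact mul_nonneg (hl.1 i) (hl.1 j)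
      · exact h i j
    have e : d l = ∑ i, l i * ‖c i‖ ^ 2 - ∑ i, l i * ‖R i‖ ^ 2 - ‖∑ i, l i • c i‖ ^ 2 := by
      simp [d, mul_sub, Finset.sum_sub_distrib]
    nlinarith [sq_nonneg ‖∑ i, l i • R i‖]
  set z := ∑ i, l i • c i with hz
  refine ⟨z, fun i => ?_⟩
  -- Moving `l` towards the `i`-th vertex does not increase `d`; divide by the step and let it
  -- tend to zero.
  have key : ∀ t ∈ Set.Ioc (0 : ℝ) 1, ‖z - c i‖ ^ 2 - ‖R i‖ ^ 2 ≤ t * ‖z - c i‖ ^ 2 := by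
    intro t ht
    have hm : (1 - t) • l + t • Pi.single i (1 : ℝ) ∈ stdSimplex ℝ ι :=
      (convex_stdSimplex ℝ ι) hl (single_mem_stdSimplex ℝ i) (by linarith [ht.2]) ht.1.le (by ring)
    have h1 : d ((1 - t) • l + t • Pi.single i (1 : ℝ)) ≤ d l := hmax hm
    have e1 : ∑ j, ((1 - t) • l + t • Pi.single i (1 : ℝ) : ι → ℝ) j • c j = (1 - t) • z + t • c i := by
      simp [add_smul, Finset.sum_add_distrib, hz, Finset.smul_sum, mul_smul, Pi.single_apply,
        ite_smul]
    have e2 : ∑ j, ((1 - t) • l + t • Pi.single i (1 : ℝ) : ι → ℝ) j * (‖c j‖ ^ 2 - ‖R j‖ ^ 2)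
        = (1 - t) * ∑ j, l j * (‖c j‖ ^ 2 - ‖R j‖ ^ 2) + t * (‖c i‖ ^ 2 - ‖R i‖ ^ 2) := by
      simp [add_mul, Finset.sum_add_distrib, Finset.mul_sum, mul_assoc, Pi.single_apply]
    have e3 : ‖(1 - t) • z + t • c i‖ ^ 2
        = (1 - t) * ‖z‖ ^ 2 + t * ‖c i‖ ^ 2 - t * (1 - t) * ‖z - c i‖ ^ 2 := by
      rw [norm_add_sq_real, norm_sub_sq_real, norm_smul, norm_smul, real_inner_smul_left,
        real_inner_smul_right, mul_pow, mul_pow, Real.norm_eq_abs, Real.norm_eq_abs, sq_abs, sq_abs]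
      ring
    simp only [d] at h1 hd0
    rw [e1, e2, e3, ← hz] at h1
    rw [← hz] at hd0
    refine le_of_mul_le_mul_left ?_ ht.1
    nlinarith [mul_nonneg ht.1.le (neg_nonneg.2 hd0)]
  have hsq : ‖z - c i‖ ^ 2 - ‖R i‖ ^ 2 ≤ 0 := by
    refine ge_of_tendsto (f := fun t : ℝ => t * ‖z - c i‖ ^ 2) (x := 𝓝[>] 0) ?_ ?_
    · have : Continuous fun t : ℝ => t * ‖z - c i‖ ^ 2 := by fun_prop
      simpa using (this.tendsto 0).mono_left nhdsWithin_le_nhds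
    · filter_upwards [Ioc_mem_nhdsGT (zero_lt_one' ℝ)] with t ht using key t ht
  exact (sq_le_sq₀ (norm_nonneg _) (norm_nonneg _)).1 (by linarith)

/-- The Kirszbraun intersection property for arbitrary families, from the finite one by weak
compactness. -/
theorem exists_forall_norm_sub_le [CompleteSpace H] (c R : ι → H)
    (h : ∀ i j, ‖c i - c j‖ ≤ ‖R i - R j‖) : ∃ z, ∀ i, ‖z - c i‖ ≤ ‖R i‖ := by
  classical
  rcases isEmpty_or_nonempty ι with hι | ⟨⟨i₀⟩⟩
  · exact ⟨0, fun i => hι.elim i⟩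
  have hfin : ∀ s : Finset ι, ∃ z, ∀ i ∈ s, ‖z - c i‖ ≤ ‖R i‖ := by
    intro s
    rcases s.eq_empty_or_nonempty with rfl | hs
    · exact ⟨0, by simp⟩
    · have := hs.to_subtype
      obtain ⟨z, hz⟩ := exists_forall_norm_sub_le_of_fintype (fun i : s => c i) (fun i : s => R i)
        fun i j => h i j
      exact ⟨z, fun i hi => hz ⟨i, hi⟩⟩
  choose z hz using hfin
  let U : Ultrafilter (Finset ι) := Ultrafilter.of atTop
  have hU : ∀ i, ∀ᶠ s in (U : Filter (Finset ι)), ‖z s - c i‖ ≤ ‖R i‖ := fun i =>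
    Ultrafilter.of_le atTop ((eventually_ge_atTop {i}).mono fun s hs => hz s i (by simpa using hs))
  obtain ⟨w, hw⟩ := exists_weakTendsto U (x := z) (C := ‖R i₀‖ + ‖c i₀‖) (by
    filter_upwards [hU i₀] with s hs
    linarith [norm_le_norm_sub_add (z s) (c i₀)])
  refine ⟨w, fun i => ?_⟩
  have h1 : Tendsto (fun s => inner ℝ (z s - c i) (w - c i)) U (𝓝 (inner ℝ (w - c i) (w - c i))) := by
    simpa only [inner_sub_left] using (hw (w - c i)).sub_const _
  have h2 : inner ℝ (w - c i) (w - c i) ≤ ‖R i‖ * ‖w - c i‖ :=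
    le_of_tendsto h1 ((hU i).mono fun s hs =>
      (real_inner_le_norm _ _).trans (by gcongr))
  rw [real_inner_self_eq_norm_sq] at h2
  rcases (norm_nonneg (w - c i)).eq_or_lt with h0 | h0
  · rw [← h0]; exact norm_nonneg _
  · exact le_of_mul_le_mul_right (by linarith [sq ‖w - c i‖]) h0

end Kirszbraun

section Monotone

theorem mem_inclusionSolutions_iff_neg_mem {H : Type*} [NormedAddCommGroup H]
    {B : H → Set H} {f : H → H} {x : H} : x ∈ inclusionSolutions B f ↔ -f x ∈ B x := by
  constructor
  · rintro ⟨b, hb, h⟩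
    rwa [← eq_neg_of_add_eq_zero_left h]
  · exact fun h => ⟨_, h, neg_add_cancel _⟩

variable {H : Type*} [NormedAddCommGroup H] [InnerProductSpace ℝ H] {B : H → Set H}

/-- A pair in monotone relation to the whole graph belongs to it. -/
theorem IsMaximalMonotone.mem_of_forall (hB : IsMaximalMonotone B) {y v : H}
    (h : ∀ x, ∀ b ∈ B x, 0 ≤ inner ℝ (b - v) (x - y)) : v ∈ B y := by
  by_contra hv
  refine hB.2 (fun x => B x ∪ {p | x = y ∧ p = v}) ?_ ?_
  · rintro a b u (hu | ⟨rfl, rfl⟩) w (hw | ⟨rfl, rfl⟩)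
    · exact hB.1 _ _ _ hu _ hw
    · exact h _ _ hu
    · have := h _ _ hw
      rwa [← neg_sub w, ← neg_sub b, inner_neg_neg]
    · simp
  · exact ⟨fun p hp => Or.inl hp, fun hsub => hv (hsub (Or.inr ⟨rfl, rfl⟩ :
      (y, v) ∈ graph fun x => B x ∪ {p | x = y ∧ p = v}))⟩

/-- Minty's theorem: `I + lam B` is onto. The inequality `⟪b - (x - y) / lam, a - y⟫ ≥ 0` for a
point `(a, b)` of the graph says that `y` lies in the ball with centre `(a + x - lam b) / 2` and
radius `‖a + lam b - x‖ / 2`; by monotonicity these balls have a common point. -/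
theorem IsMaximalMonotone.resolventValues_nonempty [CompleteSpace H] (hB : IsMaximalMonotone B)
    {lam : ℝ} (hl : 0 < lam) (x : H) : (resolventValues B lam x).Nonempty := by
  obtain ⟨y, hy⟩ := exists_forall_norm_sub_le
    (fun p : graph B => (1 / 2 : ℝ) • (p.1.1 + x - lam • p.1.2))
    (fun p : graph B => (1 / 2 : ℝ) • (p.1.1 + lam • p.1.2 - x)) (by
      rintro ⟨⟨a, b⟩, hp⟩ ⟨⟨a', b'⟩, hp'⟩
      have hm := hB.1 a a' b hp b' hp'
      have e1 : (1 / 2 : ℝ) • (a + x - lam • b) - (1 / 2 : ℝ) • (a' + x - lam • b')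
          = (1 / 2 : ℝ) • ((a - a') - lam • (b - b')) := by module
      have e2 : (1 / 2 : ℝ) • (a + lam • b - x) - (1 / 2 : ℝ) • (a' + lam • b' - x)
          = (1 / 2 : ℝ) • ((a - a') + lam • (b - b')) := by module
      simp only [e1, e2, norm_smul]
      refine mul_le_mul_of_nonneg_left ((sq_le_sq₀ (norm_nonneg _) (norm_nonneg _)).1 ?_) (norm_nonneg _)
      rw [norm_sub_sq_real, norm_add_sq_real, real_inner_smul_right, real_inner_comm]
      nlinarith [mul_nonneg hl.le hm])
  refine ⟨y, lam⁻¹ • (x - y), hB.mem_of_forall fun a b hb => ?_, ?_⟩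
  · have h := hy ⟨(a, b), hb⟩
    have h2 := pow_le_pow_left₀ (norm_nonneg _) h 2
    have e1 : y - (1 / 2 : ℝ) • (a + x - lam • b)
        = (1 / 2 : ℝ) • ((y - a) + (y - x + lam • b)) := by module
    have e2 : (1 / 2 : ℝ) • (a + lam • b - x)
        = (1 / 2 : ℝ) • ((y - x + lam • b) - (y - a)) := by module
    simp only [e1, e2, norm_smul, mul_pow] at h2
    rw [norm_sub_sq_real, norm_add_sq_real, real_inner_comm] at h2
    have h3 : inner ℝ (y - x + lam • b) (y - a) ≤ 0 := by norm_num at h2; linarith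
    have e3 : b - lam⁻¹ • (x - y) = lam⁻¹ • (y - x + lam • b) := by
      rw [smul_add, inv_smul_smul₀ hl.ne']; module
    rw [e3, real_inner_smul_left, ← neg_sub y a, inner_neg_right]
    exact mul_nonneg (inv_nonneg.2 hl.le) (by linarith)
  · rw [smul_inv_smul₀ hl.ne']; abel

/-- The defining inclusion of the resolvent. -/
theorem IsMaximalMonotone.smul_sub_resolventMap_mem [CompleteSpace H] (hB : IsMaximalMonotone B)
    {lam : ℝ} (hl : 0 < lam) (x : H) :
    lam⁻¹ • (x - resolventMap B lam x) ∈ B (resolventMap B lam x) := by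
  obtain ⟨b, hb, h⟩ := Classical.epsilon_spec (hB.resolventValues_nonempty hl x)
  change b ∈ B (resolventMap B lam x) at hb
  change resolventMap B lam x + lam • b = x at h
  rwa [← eq_sub_iff_add_eq'.2 h, inv_smul_smul₀ hl.ne']

/-- The graph of a maximal monotone operator is closed under weak convergence of the points and norm
convergence of the values. -/
theorem IsMaximalMonotone.mem_of_weakTendsto {ι : Type*} {l : Filter ι} [l.NeBot]
    (hB : IsMaximalMonotone B) {x b : ι → H} {w v : H} {C : ℝ} (hx : WeakTendsto x l w)
    (hC : ∀ᶠ i in l, ‖x i‖ ≤ C) (hb : Tendsto b l (𝓝 v)) (h : ∀ᶠ i in l, b i ∈ B (x i)) :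
    v ∈ B w := by
  refine hB.mem_of_forall fun a q hq => ?_
  have hqb : Tendsto (fun i => q - b i) l (𝓝 (q - v)) := hb.const_sub q
  have h1 : Tendsto (fun i => inner ℝ (q - b i) (a - x i)) l (𝓝 (inner ℝ (q - v) (a - w))) := by
    have := (hqb.inner (tendsto_const_nhds (x := a))).sub (hx.inner_tendsto hC hqb)
    simpa only [inner_sub_right, real_inner_comm] using this
  exact ge_of_tendsto h1 (h.mono fun i hi => hB.1 _ _ _ hq _ hi)

/-! ### Inclusions `0 ∈ B x + f x` -/

variable {τ : ℝ} {f : H → H}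

theorem IsInverseStronglyMonotone.norm_sub_le (hf : IsInverseStronglyMonotone τ f) (x y : H) :
    τ * ‖f x - f y‖ ≤ ‖x - y‖ := by
  rcases (norm_nonneg (f x - f y)).eq_or_lt with h0 | h0
  · rw [← h0]; simp
  · refine le_of_mul_le_mul_left ?_ h0
    nlinarith [hf.2 x y, real_inner_le_norm (f x - f y) (x - y)]

/-- Minty's characterization of the zeros of `B + f` by a family of linear inequalities. -/
theorem mem_inclusionSolutions_iff_forall [CompleteSpace H] (hB : IsMaximalMonotone B)
    (hf : IsInverseStronglyMonotone τ f) {x : H} :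
    x ∈ inclusionSolutions B f ↔ ∀ y, ∀ b ∈ B y, 0 ≤ inner ℝ (b + f y) (y - x) := by
  rw [mem_inclusionSolutions_iff_neg_mem]
  constructor
  · intro hx y b hb
    have h1 := hB.1 _ _ _ hb _ hx
    have h2 := hf.2 y x
    have h3 : 0 ≤ τ * ‖f y - f x‖ ^ 2 := mul_nonneg hf.1.le (sq_nonneg _)
    have e : b + f y = (b - -f x) + (f y - f x) := by abel
    rw [e, inner_add_left]
    linarith
  · intro h
    -- A forward-backward step from `x` with a step size below `τ` does not move `x`.
    have hl : 0 < τ / 2 := half_pos hf.1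
    have hm := hB.smul_sub_resolventMap_mem hl (x - (τ / 2) • f x)
    set y := resolventMap B (τ / 2) (x - (τ / 2) • f x)
    have h1 := h y _ hm
    have e : (τ / 2)⁻¹ • (x - (τ / 2) • f x - y) + f y
        = (f y - f x) - (τ / 2)⁻¹ • (y - x) := by
      rw [show x - (τ / 2) • f x - y = -(τ / 2) • f x - (y - x) by module, smul_sub, neg_smul,
        smul_neg, inv_smul_smul₀ hl.ne']
      abel
    rw [e, inner_sub_left, real_inner_smul_left, real_inner_self_eq_norm_sq] at h1
    have h2 := mul_le_mul_of_nonneg_left h1 hl.le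
    rw [mul_sub, mul_inv_cancel_left₀ hl.ne', mul_zero] at h2
    have h3 := real_inner_le_norm (f y - f x) (y - x)
    have h4 := hf.norm_sub_le y x
    have h5 : ‖y - x‖ ^ 2 ≤ 0 := by
      nlinarith [norm_nonneg (y - x), mul_le_mul_of_nonneg_right h4 (norm_nonneg (y - x))]
    have h6 : y = x := by
      rw [← sub_eq_zero, ← norm_eq_zero]
      exact pow_eq_zero_iff two_ne_zero |>.1 (le_antisymm h5 (sq_nonneg _))
    rw [h6] at hm
    rwa [sub_sub_cancel_left, smul_neg, inv_smul_smul₀ hl.ne'] at hm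

theorem inclusionSolutions_eq_iInter [CompleteSpace H] (hB : IsMaximalMonotone B)
    (hf : IsInverseStronglyMonotone τ f) :
    inclusionSolutions B f = ⋂ y, ⋂ b ∈ B y, {x | inner ℝ (b + f y) x ≤ inner ℝ (b + f y) y} := by
  ext x
  simp [mem_inclusionSolutions_iff_forall hB hf, inner_sub_right]

theorem isClosed_inclusionSolutions [CompleteSpace H] (hB : IsMaximalMonotone B)
    (hf : IsInverseStronglyMonotone τ f) : IsClosed (inclusionSolutions B f) := by
  rw [inclusionSolutions_eq_iInter hB hf]
  exact isClosed_iInter fun y => isClosed_biInter fun b _ =>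
    isClosed_le (by fun_prop) continuous_const

theorem convex_inclusionSolutions [CompleteSpace H] (hB : IsMaximalMonotone B)
    (hf : IsInverseStronglyMonotone τ f) : Convex ℝ (inclusionSolutions B f) := by
  rw [inclusionSolutions_eq_iInter hB hf]
  exact convex_iInter fun y => convex_iInter fun b => convex_iInter fun _ =>
    convex_halfSpace_le (innerₛₗ ℝ (b + f y)).isLinear _

/-- Demiclosedness: if the residuals of approximate solutions vanish in norm, their weak limit
solves the inclusion. -/
theorem mem_inclusionSolutions_of_weakTendsto {ι : Type*} {l : Filter ι} [l.NeBot]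
    (hB : IsMaximalMonotone B) (hf : IsInverseStronglyMonotone τ f) {x y b : ι → H} {w q : H}
    {C : ℝ} (hx : WeakTendsto x l w) (hC : ∀ᶠ i in l, ‖x i‖ ≤ C)
    (hyx : Tendsto (fun i => y i - x i) l (𝓝 0)) (hb : ∀ᶠ i in l, b i ∈ B (y i))
    (hbq : Tendsto b l (𝓝 (-q))) (hfq : Tendsto (fun i => f (x i)) l (𝓝 q)) :
    w ∈ inclusionSolutions B f := by
  have hfw : f w = q := by
    have h1 : Tendsto (fun i => inner ℝ (f (x i) - f w) (x i - w)) l (𝓝 0) := by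
      have h2 : Tendsto (fun i => f (x i) - f w) l (𝓝 (q - f w)) := hfq.sub_const _
      have := (hx.inner_tendsto hC h2).sub (h2.inner (tendsto_const_nhds (x := w)))
      simpa only [inner_sub_right, real_inner_comm, sub_self] using this
    have h2 : Tendsto (fun i => τ * ‖f (x i) - f w‖ ^ 2) l (𝓝 (τ * ‖q - f w‖ ^ 2)) :=
      ((hfq.sub_const _).norm.pow 2).const_mul τ
    have h3 : τ * ‖q - f w‖ ^ 2 ≤ 0 := le_of_tendsto_of_tendsto' h2 h1 fun i => hf.2 _ _
    have h4 : ‖q - f w‖ ^ 2 ≤ 0 := nonpos_of_mul_nonpos_right h3 hf.1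
    have h5 : ‖q - f w‖ = 0 := pow_eq_zero_iff two_ne_zero |>.1 (le_antisymm h4 (sq_nonneg _))
    exact (sub_eq_zero.1 (norm_eq_zero.1 h5)).symm
  rw [mem_inclusionSolutions_iff_neg_mem, hfw]
  refine hB.mem_of_weakTendsto (hx.add_of_tendsto_sub hyx) (C := C + 1) ?_ hbq hb
  have h1 : ∀ᶠ i in l, ‖y i - x i‖ < 1 := by
    simpa using hyx.norm.eventually_lt_const (by simp : ‖(0 : H)‖ < 1)
  filter_upwards [hC, h1] with i h2 h3
  linarith [norm_le_norm_sub_add (y i) (x i)]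

end Monotone

/-! ### The variational inequality -/

section VI

variable {H : Type*} [NormedAddCommGroup H] [InnerProductSpace ℝ H] {F : H → H} {γ : ℝ} {S : Set H}

theorem SolvesVI.eq (hF : IsStronglyMonotone γ F) {u v : H} (hu : SolvesVI F S u)
    (hv : SolvesVI F S v) : v = u := by
  have h1 := hu.2 v hv.1
  have h2 := hv.2 u hu.1
  have h3 := hF.2 v u
  rw [← neg_sub v u, inner_neg_right] at h2
  rw [inner_sub_left] at h3
  have h4 : ‖v - u‖ ^ 2 ≤ 0 := nonpos_of_mul_nonpos_right (by linarith) hF.1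
  have h5 : ‖v - u‖ = 0 := pow_eq_zero_iff two_ne_zero |>.1 (le_antisymm h4 (sq_nonneg _))
  exact sub_eq_zero.1 (norm_eq_zero.1 h5)

/-- The solution is the fixed point of the contraction `x ↦ P (x - μ F x)`, where `P` is the metric
projection onto `S` and `μ` is small. -/
theorem exists_solvesVI [CompleteSpace H] (hF : IsStronglyMonotone γ F) {L : ℝ≥0}
    (hL : LipschitzWith L F) (hS : S.Nonempty) (hcl : IsClosed S) (hco : Convex ℝ S) :
    ∃ u, SolvesVI F S u := by
  have hproj : ∀ x, ∃ p ∈ S, ∀ w ∈ S, inner ℝ (x - p) (w - p) ≤ 0 := by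
    intro x
    obtain ⟨p, hp, h⟩ := exists_norm_eq_iInf_of_complete_convex hS hcl.isComplete hco x
    exact ⟨p, hp, (norm_eq_iInf_iff_real_inner_le_zero hco hp).1 h⟩
  choose P hPS hP using hproj
  have hPlip : ∀ x y, ‖P x - P y‖ ≤ ‖x - y‖ := by
    intro x y
    have h1 := hP x (P y) (hPS y)
    have h2 := hP y (P x) (hPS x)
    have h3 : ‖P x - P y‖ ^ 2 ≤ inner ℝ (x - y) (P x - P y) := by
      rw [← real_inner_self_eq_norm_sq]
      simp only [inner_sub_left, inner_sub_right] at h1 h2 ⊢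
      linarith
    rcases (norm_nonneg (P x - P y)).eq_or_lt with h0 | h0
    · rw [← h0]; exact norm_nonneg _
    · refine le_of_mul_le_mul_right ?_ h0
      nlinarith [real_inner_le_norm (x - y) (P x - P y)]
  have hγ := hF.1
  -- `K` is a positive Lipschitz constant that is at least `γ`.
  set K : ℝ := L + γ with hK
  have hLK : (L : ℝ) ≤ K := by linarith
  have hγK : γ ≤ K := by linarith [L.2]
  have hK0 : 0 < K := by linarith
  set μ : ℝ := γ / K ^ 2 with hμ
  have hμ0 : 0 < μ := by positivity
  have hμK : μ * K ^ 2 = γ := by rw [hμ]; field_simp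
  have hq : 0 ≤ 1 - μ * γ := by
    have : μ * γ ≤ 1 := by
      rw [hμ, div_mul_eq_mul_div, div_le_one (by positivity)]; nlinarith
    linarith
  have hlip : LipschitzWith (Real.toNNReal (√(1 - μ * γ))) fun x => P (x - μ • F x) := by
    refine LipschitzWith.of_dist_le_mul fun x y => ?_
    rw [dist_eq_norm, dist_eq_norm, Real.coe_toNNReal _ (Real.sqrt_nonneg _)]
    refine (hPlip _ _).trans ((sq_le_sq₀ (norm_nonneg _) (by positivity)).1 ?_)
    rw [mul_pow, Real.sq_sqrt hq,
      show x - μ • F x - (y - μ • F y) = (x - y) - μ • (F x - F y) by module,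
      norm_sub_sq_real, real_inner_smul_right, norm_smul, mul_pow, Real.norm_eq_abs, sq_abs,
      real_inner_comm]
    have h1 := hF.2 x y
    have h2 : ‖F x - F y‖ ≤ K * ‖x - y‖ := by
      have := hL.dist_le_mul x y
      rw [dist_eq_norm, dist_eq_norm] at this
      exact this.trans (by gcongr)
    have h3 := pow_le_pow_left₀ (norm_nonneg _) h2 2
    calc ‖x - y‖ ^ 2 - 2 * (μ * inner ℝ (F x - F y) (x - y)) + μ ^ 2 * ‖F x - F y‖ ^ 2
        ≤ ‖x - y‖ ^ 2 - 2 * (μ * (γ * ‖x - y‖ ^ 2)) + μ ^ 2 * (K * ‖x - y‖) ^ 2 := by gcongr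
      _ = ‖x - y‖ ^ 2 - 2 * (μ * (γ * ‖x - y‖ ^ 2)) + μ * (μ * K ^ 2) * ‖x - y‖ ^ 2 := by ring
      _ = (1 - μ * γ) * ‖x - y‖ ^ 2 := by rw [hμK]; ring
  have hcontr : ContractingWith (Real.toNNReal (√(1 - μ * γ))) fun x => P (x - μ • F x) := by
    refine ⟨?_, hlip⟩
    rw [Real.toNNReal_lt_one, Real.sqrt_lt' one_pos]
    nlinarith [mul_pos hμ0 hγ]
  set u := ContractingWith.fixedPoint _ hcontr
  have hu : P (u - μ • F u) = u := hcontr.fixedPoint_isFixedPt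
  refine ⟨u, hu ▸ hPS _, fun x hx => ?_⟩
  have h1 := hP (u - μ • F u) x hx
  rw [hu, sub_sub_cancel_left, inner_neg_left, real_inner_smul_left] at h1
  exact nonneg_of_mul_nonneg_right (by linarith) hμ0

end VI

/-! ### Real sequences with a descent inequality -/

section Real

/-- If the drift `h` is eventually negative along every ultrafilter along which `s` stays away from
zero and the decrease `η` vanishes, then `s` tends to zero: away from zero either `η` or `-h` is
bounded below, so `s` decreases by a fixed multiple of `α`, whose sum diverges. -/
theorem tendsto_zero_of_descent {s η α h : ℕ → ℝ} {M : ℝ} (hs : ∀ n, 0 ≤ s n)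
    (hα0 : ∀ᶠ n in atTop, 0 ≤ α n) (hα : Tendsto α atTop (𝓝 0))
    (hsum : Tendsto (fun N => ∑ n ∈ Finset.range N, α n) atTop atTop) (hη : ∀ n, 0 ≤ η n)
    (hM : ∀ᶠ n in atTop, h n ≤ M)
    (hrec : ∀ᶠ n in atTop, s (n + 1) ≤ s n - η n + α n * h n)
    (hU : ∀ U : Ultrafilter ℕ, (U : Filter ℕ) ≤ atTop → ∀ ε > 0, (∀ᶠ n in (U : Filter ℕ), ε ≤ s n) →
      Tendsto η U (𝓝 0) → ∃ δ > 0, ∀ᶠ n in (U : Filter ℕ), h n ≤ -δ) :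
    Tendsto s atTop (𝓝 0) := by
  have huniform : ∀ ε > 0, ∃ δ > 0, ∀ᶠ n in atTop, ε ≤ s n → η n ≤ δ → h n ≤ -δ := by
    intro ε hε
    -- Counterexamples for `δ = 1 / (k + 1)` carry a free ultrafilter that violates `hU`.
    by_contra! hcon
    have hex : ∀ k : ℕ, ∃ n ≥ k, ε ≤ s n ∧ η n ≤ 1 / ((k : ℝ) + 1) ∧ -(1 / ((k : ℝ) + 1)) < h n :=
      fun k => (frequently_atTop.1 (hcon _ Nat.one_div_pos_of_nat)) k
    choose φ hφk hφs hφη hφh using hex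
    have hφ : Tendsto φ atTop atTop := tendsto_atTop_mono hφk tendsto_id
    have hlim : Tendsto (fun k : ℕ => 1 / ((k : ℝ) + 1)) (hyperfilter ℕ) (𝓝 0) :=
      tendsto_one_div_add_atTop_nhds_zero_nat.mono_left Nat.hyperfilter_le_atTop
    obtain ⟨δ, hδ, hev⟩ := hU ((hyperfilter ℕ).map φ)
      ((map_mono Nat.hyperfilter_le_atTop).trans hφ) ε hε
      (eventually_map.2 (Eventually.of_forall hφs))
      (tendsto_map'_iff.2 (squeeze_zero (fun _ => hη _) hφη hlim))
    obtain ⟨k, hk1, hk2⟩ := ((eventually_map.1 hev).and (hlim.eventually_lt_const hδ)).exists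
    linarith [hφh k]
  have hbound : ∀ ε > 0, ∀ᶠ n in atTop, s n ≤ 2 * ε := by
    intro ε hε
    obtain ⟨δ, hδ, hev⟩ := huniform ε hε
    set M' := max M 0
    have hαM : Tendsto (fun n => α n * M') atTop (𝓝 0) := by simpa using hα.mul_const M'
    obtain ⟨N, hN⟩ := eventually_atTop.1 (hev.and (hα0.and (hM.and (hrec.and
      ((hα.eventually_le_const (by norm_num : (0 : ℝ) < 1 / 2)).and
      ((hαM.eventually_le_const (half_pos hδ)).and (hαM.eventually_le_const hε)))))))
    have hdec : ∀ n ≥ N, ε ≤ s n → s (n + 1) ≤ s n - δ * α n := by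
      intro n hn hsn
      obtain ⟨h1, h2, h3, h4, h5, h6, -⟩ := hN n hn
      rcases le_or_gt (η n) δ with h7 | h7
      · have := mul_le_mul_of_nonneg_left (h1 hsn h7) h2
        linarith [hη n]
      · have := mul_le_mul_of_nonneg_left (h3.trans (le_max_left M 0)) h2
        have := mul_le_mul_of_nonneg_left h5 hδ.le
        linarith
    have hsmall : ∀ n ≥ N, s n < ε → s (n + 1) ≤ 2 * ε := by
      intro n hn hsn
      obtain ⟨-, h2, h3, h4, -, -, h6⟩ := hN n hn
      have := mul_le_mul_of_nonneg_left (h3.trans (le_max_left M 0)) h2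
      linarith [hη n]
    -- Otherwise `s` would fall below zero, by divergence of `∑ α n`.
    obtain ⟨n₀, hn₀, hsn₀⟩ : ∃ n ≥ N, s n < ε := by
      by_contra! hcon
      have hle : ∀ n ≥ N, s n ≤ s N - δ * (∑ i ∈ Finset.range n, α i - ∑ i ∈ Finset.range N, α i) := by
        intro n hn
        induction n, hn using Nat.le_induction with
        | base => simp
        | succ n hn ih =>
          rw [Finset.sum_range_succ]
          linarith [hdec n hn (hcon n hn)]
      obtain ⟨n, hn1, hn2⟩ := ((eventually_ge_atTop N).and (hsum.eventually_gt_atTop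
        (s N / δ + ∑ i ∈ Finset.range N, α i))).exists
      have h1 : δ * (s N / δ) = s N := mul_div_cancel₀ _ hδ.ne'
      nlinarith [hle n hn1, hs n]
    filter_upwards [eventually_ge_atTop n₀] with n hn
    induction n, hn using Nat.le_induction with
    | base => linarith
    | succ n hn ih =>
      rcases le_or_gt ε (s n) with h1 | h1
      · have := mul_nonneg hδ.le (hN n (hn₀.le.trans hn)).2.1
        linarith [hdec n (hn₀.le.trans hn) h1]
      · exact hsmall n (hn₀.le.trans hn) h1
  rw [Metric.tendsto_nhds]
  intro ε hε
  filter_upwards [hbound (ε / 4) (by positivity)] with n hn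
  rw [Real.dist_eq, sub_zero, abs_of_nonneg (hs n)]
  linarith

/-- Above the level `D / κ` the drift is nonpositive, and one step from below that level gains at
most `D`. -/
theorem exists_bound_of_descent {s α h : ℕ → ℝ} {κ D : ℝ} {N : ℕ} (hs : ∀ n, 0 ≤ s n) (hκ : 0 < κ)
    (hD : 0 ≤ D) (hα : ∀ n ≥ N, 0 ≤ α n ∧ α n ≤ 1)
    (hrec : ∀ n ≥ N, s (n + 1) ≤ s n + α n * h n) (hh : ∀ n ≥ N, h n ≤ D - κ * s n) :
    ∃ R, ∀ n ≥ N, s n ≤ R := by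
  refine ⟨max (s N) (D / κ + D), fun n hn => ?_⟩
  induction n, hn using Nat.le_induction with
  | base => exact le_max_left _ _
  | succ n hn ih =>
    have h1 := hrec n hn
    have h2 := hh n hn
    obtain ⟨h3, h4⟩ := hα n hn
    rcases le_or_gt (s n) (D / κ) with h5 | h5
    · refine le_trans ?_ (le_max_right _ _)
      have h6 : h n ≤ D := by linarith [mul_nonneg hκ.le (hs n)]
      nlinarith [mul_le_mul_of_nonneg_left h6 h3]
    · refine le_trans ?_ ih
      have h6 : h n ≤ 0 := by
        rw [div_lt_iff₀ hκ] at h5; linarith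
      linarith [mul_nonpos_of_nonneg_of_nonpos h3 h6]

end Real

/-! ### One step of the iteration -/

section Step

theorem norm_add_sq_le_young {H : Type*} [NormedAddCommGroup H] [InnerProductSpace ℝ H] {ε : ℝ}
    (hε : 0 < ε) (x y : H) : ‖x + y‖ ^ 2 ≤ (1 + ε) * ‖x‖ ^ 2 + (1 + ε⁻¹) * ‖y‖ ^ 2 := by
  have h1 : 2 * (‖x‖ * ‖y‖) ≤ ε * ‖x‖ ^ 2 + ε⁻¹ * ‖y‖ ^ 2 := by
    have h2 : ε * ‖x‖ ^ 2 + ε⁻¹ * ‖y‖ ^ 2 - 2 * (‖x‖ * ‖y‖) = ε⁻¹ * (ε * ‖x‖ - ‖y‖) ^ 2 := by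
      field_simp; ring
    have h3 : 0 ≤ ε⁻¹ * (ε * ‖x‖ - ‖y‖) ^ 2 := by positivity
    linarith
  rw [norm_add_sq_real]
  linarith [real_inner_le_norm x y]

section Resolvent

variable {H : Type*} [NormedAddCommGroup H] [InnerProductSpace ℝ H] [CompleteSpace H]
  {B : H → Set H} {f : H → H} {τ lam : ℝ}

/-- Firm nonexpansiveness of the resolvent, compared with a point of the graph. -/
theorem IsMaximalMonotone.inner_resolventMap_nonneg (hB : IsMaximalMonotone B) (hl : 0 < lam)
    {q p : H} (hp : p ∈ B q) (x : H) :
    0 ≤ inner ℝ (x - resolventMap B lam x - lam • p) (resolventMap B lam x - q) := by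
  have h := hB.1 _ _ _ (hB.smul_sub_resolventMap_mem hl x) _ hp
  have e : x - resolventMap B lam x - lam • p
      = lam • (lam⁻¹ • (x - resolventMap B lam x) - p) := by
    rw [smul_sub, smul_inv_smul₀ hl.ne']
  rw [e, real_inner_smul_left]
  exact mul_nonneg hl.le h

/-- The displacement `v - T v` of the forward-backward map `T` is `1/2`-inverse strongly monotone
with respect to a fixed point `q`, with a surplus that controls `f v - f q`. -/
theorem inner_sub_forwardBackward (hB : IsMaximalMonotone B) (hf : IsInverseStronglyMonotone τ f)
    (hl : 0 < lam) {q : H} (hq : q ∈ inclusionSolutions B f) (v : H) :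
    1 / 2 * ‖v - forwardBackward B f lam v‖ ^ 2 + 1 / 2 * lam * (2 * τ - lam) * ‖f v - f q‖ ^ 2
      ≤ inner ℝ (v - forwardBackward B f lam v) (v - q) := by
  have h := hB.inner_resolventMap_nonneg hl (mem_inclusionSolutions_iff_neg_mem.1 hq)
    (v - lam • f v)
  change 0 ≤ inner ℝ (v - lam • f v - forwardBackward B f lam v - lam • -f q)
    (forwardBackward B f lam v - q) at h
  set e := v - forwardBackward B f lam v with he
  have e1 : v - lam • f v - forwardBackward B f lam v - lam • -f q = e - lam • (f v - f q) := by
    rw [he]; module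
  have e2 : forwardBackward B f lam v - q = (v - q) - e := by rw [he]; abel
  rw [e1, e2] at h
  simp only [inner_sub_left _ (lam • _), inner_sub_right _ _ e, real_inner_smul_left,
    real_inner_self_eq_norm_sq] at h
  have h1 := mul_le_mul_of_nonneg_left (hf.2 v q) hl.le
  have h2 := sq_nonneg ‖e - lam • (f v - f q)‖
  rw [norm_sub_sq_real, real_inner_smul_right, norm_smul, mul_pow, Real.norm_eq_abs, sq_abs,
    real_inner_comm (f v - f q) e] at h2
  linarith

end Resolvent

variable {H₁ H₂ : Type*} [NormedAddCommGroup H₁] [InnerProductSpace ℝ H₁] [CompleteSpace H₁]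
  [NormedAddCommGroup H₂] [InnerProductSpace ℝ H₂] [CompleteSpace H₂]
  {B₁ : H₁ → Set H₁} {B₂ : H₂ → Set H₂} {f₁ : H₁ → H₁} {f₂ : H₂ → H₂} {A : H₁ →L[ℝ] H₂}
  {F : H₁ → H₁} {τ₁ τ₂ : ℝ}

/-- The displacement of the resolvent in one step of the iteration, relative to its value
`-lam • f₁ u` at a solution `u`. -/
noncomputable def stepResidual (B₁ : H₁ → Set H₁) (B₂ : H₂ → Set H₂) (f₁ : H₁ → H₁) (f₂ : H₂ → H₂)
    (A : H₁ →L[ℝ] H₂) (F : H₁ → H₁) (lam a : ℝ) (u z : H₁) : H₁ :=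
  (z - lam • f₁ z
      - lam • ContinuousLinearMap.adjoint A (A z - forwardBackward B₂ f₂ lam (A z))
      - (lam * a) • F z)
    - step B₁ B₂ f₁ f₂ A F lam a z + lam • f₁ u

/-- The sum of the squares of the quantities that vanish when `z` is a solution. -/
noncomputable def stepDefect (B₁ : H₁ → Set H₁) (B₂ : H₂ → Set H₂) (f₁ : H₁ → H₁) (f₂ : H₂ → H₂)
    (A : H₁ →L[ℝ] H₂) (F : H₁ → H₁) (lam a : ℝ) (u z : H₁) : ℝ :=
  ‖f₁ z - f₁ u‖ ^ 2 + ‖A z - forwardBackward B₂ f₂ lam (A z)‖ ^ 2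
    + ‖f₂ (A z) - f₂ (A u)‖ ^ 2 + ‖stepResidual B₁ B₂ f₁ f₂ A F lam a u z‖ ^ 2

theorem sq_le_stepDefect {lam a : ℝ} {u z : H₁} :
    ‖f₁ z - f₁ u‖ ^ 2 ≤ stepDefect B₁ B₂ f₁ f₂ A F lam a u z ∧
    ‖A z - forwardBackward B₂ f₂ lam (A z)‖ ^ 2 ≤ stepDefect B₁ B₂ f₁ f₂ A F lam a u z ∧
    ‖f₂ (A z) - f₂ (A u)‖ ^ 2 ≤ stepDefect B₁ B₂ f₁ f₂ A F lam a u z ∧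
    ‖stepResidual B₁ B₂ f₁ f₂ A F lam a u z‖ ^ 2 ≤ stepDefect B₁ B₂ f₁ f₂ A F lam a u z := by
  have h1 := sq_nonneg ‖f₁ z - f₁ u‖
  have h2 := sq_nonneg ‖A z - forwardBackward B₂ f₂ lam (A z)‖
  have h3 := sq_nonneg ‖f₂ (A z) - f₂ (A u)‖
  have h4 := sq_nonneg ‖stepResidual B₁ B₂ f₁ f₂ A F lam a u z‖
  unfold stepDefect
  exact ⟨by linarith, by linarith, by linarith, by linarith⟩

/-- Lower bounds for the coefficients of the squares in the energy inequality. -/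
theorem le_step_coefficients {ρ c lam k τ₁ τ₂ N : ℝ} (hρ : 2 < ρ) (hc : 0 < c) (hcl : c ≤ lam)
    (hτ₁ : 0 < τ₁) (hτ₂ : 0 < τ₂) (hl₁ : ρ * lam ≤ τ₁) (hl₂ : ρ * lam ≤ τ₂)
    (hlN : ρ * lam * N ≤ 1) (hk₁ : k ≤ c * τ₁) (hk₂ : k ≤ c * ((ρ - 2) / (2 * ρ)))
    (hk₃ : k ≤ c ^ 2 * τ₂) :
    k ≤ 2 * lam * (τ₁ - (1 + (ρ - 2) / 4) * lam) ∧
    k ≤ lam * (1 - 2 * (1 + (ρ - 2) / 4) * (lam * N)) ∧ k ≤ lam ^ 2 * (2 * τ₂ - lam) := by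
  have hl : 0 < lam := hc.trans_le hcl
  have hρlam : 2 * lam ≤ ρ * lam := mul_le_mul_of_nonneg_right hρ.le hl.le
  refine ⟨hk₁.trans ?_, hk₂.trans ?_, hk₃.trans ?_⟩
  · have h1 : τ₁ / 2 ≤ τ₁ - (1 + (ρ - 2) / 4) * lam := by linarith
    have h2 : c * τ₁ ≤ lam * τ₁ := mul_le_mul_of_nonneg_right hcl hτ₁.le
    have h3 := mul_le_mul_of_nonneg_left h1 (by linarith : 0 ≤ 2 * lam)
    linarith
  · have hρ0 : 0 < ρ := by linarith
    have h1 : lam * N ≤ 1 / ρ := by rw [le_div_iff₀ hρ0]; linarith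
    have h2 : (ρ - 2) / (2 * ρ) = 1 - 2 * (1 + (ρ - 2) / 4) * (1 / ρ) := by field_simp; ring
    have h0 : 0 ≤ (ρ - 2) / (2 * ρ) := div_nonneg (by linarith) (by linarith)
    refine mul_le_mul hcl ?_ h0 hl.le
    rw [h2]
    have := mul_le_mul_of_nonneg_left h1 (by linarith : 0 ≤ 2 * (1 + (ρ - 2) / 4))
    linarith
  · exact mul_le_mul (pow_le_pow_left₀ hc.le hcl 2) (by linarith) hτ₂.le (sq_nonneg _)

/-- The energy inequality for one step. The Young parameter `(ρ - 2) / 4` is small enough for the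
bound `ρ * lam ≤ min {τ₁, ‖A‖⁻²}` to leave a positive multiple of every term of the defect. -/
theorem norm_step_sub_sq_le (hB₁ : IsMaximalMonotone B₁) (hB₂ : IsMaximalMonotone B₂)
    (hf₁ : IsInverseStronglyMonotone τ₁ f₁) (hf₂ : IsInverseStronglyMonotone τ₂ f₂)
    {ρ c lam a k : ℝ} (hρ : 2 < ρ) (hc : 0 < c) (hcl : c ≤ lam) (hl₁ : ρ * lam ≤ τ₁)
    (hl₂ : ρ * lam ≤ τ₂) (hlA : ρ * lam * ‖A‖ ^ 2 ≤ 1)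
    (hk₁ : k ≤ c * τ₁) (hk₂ : k ≤ c * ((ρ - 2) / (2 * ρ))) (hk₃ : k ≤ c ^ 2 * τ₂) (hk₄ : k ≤ 1)
    {u : H₁} (hu : u ∈ solutionSet B₁ B₂ f₁ f₂ A) (z : H₁) :
    ‖step B₁ B₂ f₁ f₂ A F lam a z - u‖ ^ 2 ≤ ‖z - u‖ ^ 2
      - k * stepDefect B₁ B₂ f₁ f₂ A F lam a u z
      - 2 * lam * a * inner ℝ (F z) (z - u)
      + lam ^ 2 * (1 + 4 / (ρ - 2)) * (a ^ 2 * ‖F z‖ ^ 2) := by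
  have hl : 0 < lam := hc.trans_le hcl
  have hfirm := hB₁.inner_resolventMap_nonneg hl (mem_inclusionSolutions_iff_neg_mem.1 hu.1)
    (z - lam • f₁ z - lam • ContinuousLinearMap.adjoint A (A z - forwardBackward B₂ f₂ lam (A z))
      - (lam * a) • F z)
  have hfb := inner_sub_forwardBackward hB₂ hf₂ hl hu.2 (A z)
  rw [smul_neg, sub_neg_eq_add] at hfirm
  change 0 ≤ inner ℝ (stepResidual B₁ B₂ f₁ f₂ A F lam a u z)
    (step B₁ B₂ f₁ f₂ A F lam a z - u) at hfirm
  unfold stepDefect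
  set e := A z - forwardBackward B₂ f₂ lam (A z) with he
  set r := stepResidual B₁ B₂ f₁ f₂ A F lam a u z with hr
  set z' := step B₁ B₂ f₁ f₂ A F lam a z with hz'
  set g := ContinuousLinearMap.adjoint A e with hg
  set d := f₁ z - f₁ u with hd
  have hsum : r + (z' - u) = (z - u) - lam • ((d + g) + a • F z) := by
    rw [hr, stepResidual, ← he, ← hg, ← hz', hd]; module
  have h1 : ‖z' - u‖ ^ 2 + ‖r‖ ^ 2 ≤ ‖(z - u) - lam • ((d + g) + a • F z)‖ ^ 2 := by
    rw [← hsum, norm_add_sq_real]; linarith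
  rw [norm_sub_sq_real (z - u), real_inner_smul_right, norm_smul, mul_pow, Real.norm_eq_abs, sq_abs,
    inner_add_right, inner_add_right, real_inner_smul_right, real_inner_comm (F z),
    real_inner_comm d, real_inner_comm g] at h1
  have h2 : inner ℝ g (z - u) = inner ℝ e (A z - A u) := by
    rw [hg, ContinuousLinearMap.adjoint_inner_left, map_sub]
  have h3 := hf₁.2 z u
  rw [← hd] at h3
  have hε : 0 < (ρ - 2) / 4 := by linarith
  have h4 := norm_add_sq_le_young hε (d + g) (a • F z)
  have h5 := norm_add_sq_le_young one_pos d g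
  have h6 : ‖g‖ ^ 2 ≤ ‖A‖ ^ 2 * ‖e‖ ^ 2 := by
    rw [← mul_pow]
    refine pow_le_pow_left₀ (norm_nonneg _) ?_ 2
    simpa using (ContinuousLinearMap.adjoint A).le_opNorm e
  rw [norm_smul, mul_pow, Real.norm_eq_abs, sq_abs, inv_div] at h4
  have h7 : ‖d + g + a • F z‖ ^ 2 ≤ (1 + (ρ - 2) / 4) * (2 * ‖d‖ ^ 2 + 2 * (‖A‖ ^ 2 * ‖e‖ ^ 2))
      + (1 + 4 / (ρ - 2)) * (a ^ 2 * ‖F z‖ ^ 2) := by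
    refine h4.trans ?_
    gcongr
    norm_num at h5
    linarith
  have h8 := mul_le_mul_of_nonneg_left h7 (sq_nonneg lam)
  rw [h2] at h1
  obtain ⟨hcoef₁, hcoef₂, hcoef₃⟩ := le_step_coefficients hρ hc hcl hf₁.1 hf₂.1 hl₁ hl₂ hlA hk₁ hk₂ hk₃
  have h9 := mul_le_mul_of_nonneg_right hcoef₁ (sq_nonneg ‖d‖)
  have h10 := mul_le_mul_of_nonneg_right hcoef₂ (sq_nonneg ‖e‖)
  have h11 := mul_le_mul_of_nonneg_right hcoef₃ (sq_nonneg ‖f₂ (A z) - f₂ (A u)‖)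
  have h12 : k * ‖r‖ ^ 2 ≤ ‖r‖ ^ 2 := mul_le_of_le_one_left (sq_nonneg _) hk₄
  have h13 := mul_le_mul_of_nonneg_left h3 hl.le
  have h14 := mul_le_mul_of_nonneg_left hfb hl.le
  linarith

end Step

/-! ### Weak cluster points and convergence -/

section Convergence

theorem mul_le_of_lt_stepBound {H₁ H₂ : Type*} [NormedAddCommGroup H₁] [InnerProductSpace ℝ H₁]
    [NormedAddCommGroup H₂] [InnerProductSpace ℝ H₂] {A : H₁ →L[ℝ] H₂} {τ ρ lam : ℝ} (hρ : 0 < ρ)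
    (h : lam < 1 / ρ * stepBound τ A) :
    ρ * lam ≤ τ ∧ ρ * lam * ‖A‖ ^ 2 ≤ 1 := by
  have h1 : ρ * lam ≤ stepBound τ A := by
    rw [one_div_mul_eq_div, lt_div_iff₀ hρ] at h
    linarith
  unfold stepBound at h1
  split_ifs at h1 with hA
  · exact ⟨h1, by simp [hA]⟩
  · refine ⟨h1.trans (min_le_left _ _), ?_⟩
    have h2 := h1.trans (min_le_right _ _)
    rwa [le_div_iff₀ (by positivity)] at h2

theorem tendsto_smul_zero_of_abs_le {ι E : Type*} [SeminormedAddCommGroup E] [NormedSpace ℝ E]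
    {l : Filter ι} {t : ι → ℝ} {x : ι → E} {C : ℝ} (ht : ∀ᶠ i in l, |t i| ≤ C)
    (hx : Tendsto x l (𝓝 0)) : Tendsto (fun i => t i • x i) l (𝓝 0) := by
  have h : Tendsto (fun i => C * ‖x i‖) l (𝓝 0) := by simpa using hx.norm.const_mul C
  refine squeeze_zero_norm' ?_ h
  filter_upwards [ht] with i hi
  rw [norm_smul, Real.norm_eq_abs]
  gcongr

theorem tendsto_zero_of_norm_sq_le {ι E : Type*} [SeminormedAddCommGroup E] {l : Filter ι}
    {x : ι → E} {η : ι → ℝ} (hη : Tendsto η l (𝓝 0)) (h : ∀ i, ‖x i‖ ^ 2 ≤ η i) :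
    Tendsto x l (𝓝 0) := by
  have h1 : Tendsto (fun i => √(η i)) l (𝓝 0) := by simpa using hη.sqrt
  exact squeeze_zero_norm (fun i => Real.le_sqrt_of_sq_le (h i)) h1

variable {H₁ H₂ : Type*} [NormedAddCommGroup H₁] [InnerProductSpace ℝ H₁] [CompleteSpace H₁]
  [NormedAddCommGroup H₂] [InnerProductSpace ℝ H₂] [CompleteSpace H₂]
  {B₁ : H₁ → Set H₁} {B₂ : H₂ → Set H₂} {f₁ : H₁ → H₁} {f₂ : H₂ → H₂} {A : H₁ →L[ℝ] H₂}
  {F : H₁ → H₁} {τ₁ τ₂ : ℝ}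

theorem isClosed_solutionSet (hB₁ : IsMaximalMonotone B₁) (hB₂ : IsMaximalMonotone B₂)
    (hf₁ : IsInverseStronglyMonotone τ₁ f₁) (hf₂ : IsInverseStronglyMonotone τ₂ f₂) :
    IsClosed (solutionSet B₁ B₂ f₁ f₂ A) :=
  (isClosed_inclusionSolutions hB₁ hf₁).inter
    ((isClosed_inclusionSolutions hB₂ hf₂).preimage A.continuous)

theorem convex_solutionSet (hB₁ : IsMaximalMonotone B₁) (hB₂ : IsMaximalMonotone B₂)
    (hf₁ : IsInverseStronglyMonotone τ₁ f₁) (hf₂ : IsInverseStronglyMonotone τ₂ f₂) :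
    Convex ℝ (solutionSet B₁ B₂ f₁ f₂ A) :=
  (convex_inclusionSolutions hB₁ hf₁).inter
    ((convex_inclusionSolutions hB₂ hf₂).linear_preimage A.toLinearMap)

/-- A weak limit of points whose defects vanish solves the split problem. -/
theorem mem_solutionSet_of_weakTendsto {ι : Type*} {l : Filter ι} [l.NeBot]
    (hB₁ : IsMaximalMonotone B₁) (hB₂ : IsMaximalMonotone B₂)
    (hf₁ : IsInverseStronglyMonotone τ₁ f₁) (hf₂ : IsInverseStronglyMonotone τ₂ f₂)
    {x : ι → H₁} {lam a : ι → ℝ} {w u : H₁} {C M c Λ : ℝ} (hx : WeakTendsto x l w)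
    (hC : ∀ᶠ i in l, ‖x i‖ ≤ C) (hM : ∀ᶠ i in l, ‖F (x i)‖ ≤ M) (hc : 0 < c)
    (hlam : ∀ᶠ i in l, c ≤ lam i ∧ lam i ≤ Λ) (ha : Tendsto a l (𝓝 0))
    (hdef : Tendsto (fun i => stepDefect B₁ B₂ f₁ f₂ A F (lam i) (a i) u (x i)) l (𝓝 0)) :
    w ∈ solutionSet B₁ B₂ f₁ f₂ A := by
  have hd₁ : Tendsto (fun i => f₁ (x i) - f₁ u) l (𝓝 0) :=
    tendsto_zero_of_norm_sq_le hdef fun i => sq_le_stepDefect.1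
  have he : Tendsto (fun i => A (x i) - forwardBackward B₂ f₂ (lam i) (A (x i))) l (𝓝 0) :=
    tendsto_zero_of_norm_sq_le hdef fun i => sq_le_stepDefect.2.1
  have hd₂ : Tendsto (fun i => f₂ (A (x i)) - f₂ (A u)) l (𝓝 0) :=
    tendsto_zero_of_norm_sq_le hdef fun i => sq_le_stepDefect.2.2.1
  have hr : Tendsto (fun i => stepResidual B₁ B₂ f₁ f₂ A F (lam i) (a i) u (x i)) l (𝓝 0) :=
    tendsto_zero_of_norm_sq_le hdef fun i => sq_le_stepDefect.2.2.2
  have hlamΛ : ∀ᶠ i in l, |lam i| ≤ Λ := hlam.mono fun i hi => by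
    rw [abs_of_pos (hc.trans_le hi.1)]; exact hi.2
  have hlamc : ∀ᶠ i in l, |(lam i)⁻¹| ≤ c⁻¹ := hlam.mono fun i hi => by
    rw [abs_of_pos (inv_pos.2 (hc.trans_le hi.1))]; exact inv_anti₀ hc hi.1
  constructor
  · refine mem_inclusionSolutions_of_weakTendsto hB₁ hf₁ (q := f₁ u) hx hC
      (y := fun i => step B₁ B₂ f₁ f₂ A F (lam i) (a i) (x i))
      (b := fun i => (lam i)⁻¹ • stepResidual B₁ B₂ f₁ f₂ A F (lam i) (a i) u (x i) - f₁ u)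
      ?_ ?_ ?_ (by simpa using hd₁.add_const (f₁ u))
    · have h1 := tendsto_smul_zero_of_abs_le hlamΛ hd₁
      have h2 := tendsto_smul_zero_of_abs_le hlamΛ
        ((map_zero (ContinuousLinearMap.adjoint A) ▸
          ((ContinuousLinearMap.adjoint A).continuous.tendsto 0).comp he :
          Tendsto _ l (𝓝 (0 : H₁))))
      have h3 : Tendsto (fun i => a i • F (x i)) l (𝓝 0) := by
        have hlim : Tendsto (fun i => ‖a i‖ * M) l (𝓝 0) := by simpa using ha.norm.mul_const M
        refine squeeze_zero_norm' ?_ hlim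
        filter_upwards [hM] with i hi
        rw [norm_smul]
        gcongr
      have h4 := tendsto_smul_zero_of_abs_le hlamΛ h3
      have h5 := (((h1.add h2).add h4).add hr).neg
      simp only [add_zero, neg_zero] at h5
      refine h5.congr fun i => ?_
      simp only [stepResidual, Function.comp_apply]
      module
    · filter_upwards [hlam] with i hi
      have hl := hc.trans_le hi.1
      rw [stepResidual, smul_add, inv_smul_smul₀ hl.ne', add_sub_cancel_right]
      exact hB₁.smul_sub_resolventMap_mem hl _
    · simpa using (tendsto_smul_zero_of_abs_le hlamc hr).sub_const (f₁ u)
  · refine mem_inclusionSolutions_of_weakTendsto hB₂ hf₂ (q := f₂ (A u)) (hx.map A)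
      (C := ‖A‖ * C) (y := fun i => forwardBackward B₂ f₂ (lam i) (A (x i)))
      (b := fun i => (lam i)⁻¹ • (A (x i) - forwardBackward B₂ f₂ (lam i) (A (x i))) - f₂ (A (x i)))
      ?_ ?_ ?_ ?_ (by simpa using hd₂.add_const (f₂ (A u)))
    · filter_upwards [hC] with i hi
      exact (A.le_opNorm _).trans (by gcongr)
    · simpa using he.neg
    · filter_upwards [hlam] with i hi
      have hl := hc.trans_le hi.1
      have e : (lam i)⁻¹ • (A (x i) - forwardBackward B₂ f₂ (lam i) (A (x i))) - f₂ (A (x i))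
          = (lam i)⁻¹ • (A (x i) - lam i • f₂ (A (x i))
            - forwardBackward B₂ f₂ (lam i) (A (x i))) := by
        rw [sub_right_comm, smul_sub _ _ (lam i • f₂ (A (x i))), inv_smul_smul₀ hl.ne']
      rw [e]
      exact hB₂.smul_sub_resolventMap_mem hl _
    · have h1 : Tendsto (fun i => f₂ (A (x i))) l (𝓝 (f₂ (A u))) := by
        simpa using hd₂.add_const (f₂ (A u))
      simpa using (tendsto_smul_zero_of_abs_le hlamc he).sub h1

end Convergence

end SplitInclusion

/-! ### Strong convergence to the solution of the variational inequality -/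

theorem mainTheorem1
    {H₁ H₂ : Type*} [NormedAddCommGroup H₁] [InnerProductSpace ℝ H₁] [CompleteSpace H₁]
    [NormedAddCommGroup H₂] [InnerProductSpace ℝ H₂] [CompleteSpace H₂]
    (B₁ : H₁ → Set H₁) (B₂ : H₂ → Set H₂) (f₁ : H₁ → H₁) (f₂ : H₂ → H₂)
    (A : H₁ →L[ℝ] H₂) (F : H₁ → H₁)
    (τ₁ τ₂ γ : ℝ) (L : ℝ≥0)
    (hB₁ : SplitInclusion.IsMaximalMonotone B₁) (hB₂ : SplitInclusion.IsMaximalMonotone B₂)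
    (hf₁ : SplitInclusion.IsInverseStronglyMonotone τ₁ f₁)
    (hf₂ : SplitInclusion.IsInverseStronglyMonotone τ₂ f₂)
    (hFmono : SplitInclusion.IsStronglyMonotone γ F) (hFlip : LipschitzWith L F)
    (hΩ : (SplitInclusion.solutionSet B₁ B₂ f₁ f₂ A).Nonempty)
    (α lam : ℕ → ℝ) (c ρ : ℝ)
    (hα : ∀ n, 1 ≤ n → 0 < α n ∧ α n < 1)
    (hα_lim : Tendsto α atTop (𝓝 0))
    (hα_sum : Tendsto (fun N : ℕ => ∑ n ∈ Finset.Icc 1 N, α n) atTop atTop)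
    (hα_diff : Tendsto (fun n : ℕ => |α (n + 1) - α n| / α n ^ 2) atTop (𝓝 0))
    (hc : 0 < c) (hρ : 2 < ρ)
    (hlam : ∀ n, 1 ≤ n →
      c < lam n ∧ lam n < 1 / ρ * SplitInclusion.stepBound (min τ₁ τ₂) A)
    (z : ℕ → H₁)
    (hz : ∀ n, 1 ≤ n →
      z (n + 1) = SplitInclusion.step B₁ B₂ f₁ f₂ A F (lam n) (α n) (z n)) :
    ∃ u : H₁,
      SplitInclusion.SolvesVI F (SplitInclusion.solutionSet B₁ B₂ f₁ f₂ A) u ∧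
      (∀ v : H₁, SplitInclusion.SolvesVI F (SplitInclusion.solutionSet B₁ B₂ f₁ f₂ A) v → v = u) ∧
      Tendsto z atTop (𝓝 u) := by
  obtain ⟨u, hu⟩ := SplitInclusion.exists_solvesVI hFmono hFlip hΩ
    (SplitInclusion.isClosed_solutionSet hB₁ hB₂ hf₁ hf₂)
    (SplitInclusion.convex_solutionSet hB₁ hB₂ hf₁ hf₂)
  refine ⟨u, hu, fun v hv => hu.eq hFmono hv, ?_⟩
  have hγ := hFmono.1
  have hτ₁ := hf₁.1
  have hτ₂ := hf₂.1
  have hlam' : ∀ n, 1 ≤ n → c ≤ lam n ∧ ρ * lam n ≤ τ₁ ∧ ρ * lam n ≤ τ₂ ∧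
      ρ * lam n * ‖A‖ ^ 2 ≤ 1 ∧ lam n ≤ τ₁ := by
    intro n hn
    obtain ⟨h1, h2⟩ := hlam n hn
    obtain ⟨h3, h4⟩ := SplitInclusion.mul_le_of_lt_stepBound (by linarith) h2
    refine ⟨h1.le, h3.trans (min_le_left _ _), h3.trans (min_le_right _ _), h4, ?_⟩
    nlinarith [h3.trans (min_le_left _ _)]
  obtain ⟨k, hk0, hk⟩ : ∃ k : ℝ, 0 < k ∧
      (k ≤ c * τ₁ ∧ k ≤ c * ((ρ - 2) / (2 * ρ)) ∧ k ≤ c ^ 2 * τ₂ ∧ k ≤ 1) := by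
    have h1 : 0 < (ρ - 2) / (2 * ρ) := div_pos (by linarith) (by linarith)
    refine ⟨min (min (c * τ₁) (c * ((ρ - 2) / (2 * ρ)))) (min (c ^ 2 * τ₂) 1), ?_, ?_⟩
    · simp only [lt_min_iff]
      exact ⟨⟨by positivity, by positivity⟩, by positivity, one_pos⟩
    · simp only [min_le_iff]
      simp
  set C : ℝ := τ₁ ^ 2 * (1 + 4 / (ρ - 2)) with hC
  have hC0 : 0 ≤ 1 + 4 / (ρ - 2) := by
    have : 0 < ρ - 2 := by linarith
    positivity
  have hCpos : 0 ≤ C := mul_nonneg (sq_nonneg _) hC0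
  set s : ℕ → ℝ := fun n => ‖z n - u‖ ^ 2 with hs
  set η : ℕ → ℝ := fun n =>
    k * SplitInclusion.stepDefect B₁ B₂ f₁ f₂ A F (lam n) (α n) u (z n) with hη
  set h : ℕ → ℝ := fun n =>
    -2 * lam n * inner ℝ (F (z n)) (z n - u) + C * (α n * ‖F (z n)‖ ^ 2) with hh
  have hs0 : ∀ n, 0 ≤ s n := fun n => sq_nonneg _
  have hη0 : ∀ n, 0 ≤ η n := fun n => by
    simp only [hη, SplitInclusion.stepDefect]; positivity
  have hrec : ∀ n, 1 ≤ n → s (n + 1) ≤ s n - η n + α n * h n := by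
    intro n hn
    obtain ⟨h1, h2, h3, h4, h5⟩ := hlam' n hn
    have h6 := SplitInclusion.norm_step_sub_sq_le (F := F) (a := α n) hB₁ hB₂ hf₁ hf₂ hρ hc h1 h2 h3
      h4 hk.1 hk.2.1 hk.2.2.1 hk.2.2.2 hu.1 (z n)
    rw [← hz n hn] at h6
    have h7 : lam n ^ 2 * (1 + 4 / (ρ - 2)) * (α n ^ 2 * ‖F (z n)‖ ^ 2)
        ≤ C * (α n ^ 2 * ‖F (z n)‖ ^ 2) := by
      rw [hC]
      have := hc.le.trans h1
      gcongr
    simp only [hs, hη, hh]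
    linarith
  have hmono : ∀ n, γ * s n + inner ℝ (F u) (z n - u) ≤ inner ℝ (F (z n)) (z n - u) := by
    intro n
    have h1 := hFmono.2 (z n) u
    rw [inner_sub_left] at h1
    linarith
  have hFnorm : ∀ n, ‖F (z n)‖ ≤ ‖F u‖ + L * ‖z n - u‖ := by
    intro n
    have h1 := hFlip.dist_le_mul (z n) u
    rw [dist_eq_norm, dist_eq_norm] at h1
    linarith [norm_le_norm_sub_add (F (z n)) (F u)]
  set D : ℝ := τ₁ * (‖F u‖ ^ 2 / γ) + 2 * C * ‖F u‖ ^ 2 with hD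
  have hD0 : 0 ≤ D := by positivity
  obtain ⟨N, hN⟩ : ∃ N, ∀ n ≥ N, 1 ≤ n ∧ h n ≤ D - c * γ / 2 * s n := by
    have h1 : Tendsto (fun n => 2 * C * (L : ℝ) ^ 2 * α n) atTop (𝓝 0) := by
      simpa using hα_lim.const_mul (2 * C * (L : ℝ) ^ 2)
    obtain ⟨N, hN⟩ := eventually_atTop.1 ((eventually_ge_atTop 1).and
      (h1.eventually_le_const (by positivity : 0 < c * γ / 2)))
    refine ⟨N, fun n hn => ?_⟩
    obtain ⟨hn1, h2⟩ := hN n hn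
    refine ⟨hn1, ?_⟩
    obtain ⟨h3, -, -, -, h4⟩ := hlam' n hn1
    obtain ⟨h5, h6⟩ := hα n hn1
    -- Young's inequality absorbs the linear term `⟪F u, z n - u⟫` into half of `γ * s n`.
    have h7 : γ / 2 * s n - ‖F u‖ ^ 2 / γ / 2 ≤ inner ℝ (F (z n)) (z n - u) := by
      refine le_trans ?_ (hmono n)
      have h8 := neg_le_of_abs_le (abs_real_inner_le_norm (F u) (z n - u))
      have h9 : γ / 2 * s n + ‖F u‖ ^ 2 / γ / 2 - ‖F u‖ * ‖z n - u‖
          = (γ * ‖z n - u‖ - ‖F u‖) ^ 2 / (2 * γ) := by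
        simp only [hs]; field_simp; ring
      have h10 : 0 ≤ (γ * ‖z n - u‖ - ‖F u‖) ^ 2 / (2 * γ) := by positivity
      linarith
    have h11 : ‖F (z n)‖ ^ 2 ≤ 2 * ‖F u‖ ^ 2 + 2 * (L : ℝ) ^ 2 * s n := by
      have := pow_le_pow_left₀ (norm_nonneg _) (hFnorm n) 2
      simp only [hs]
      nlinarith [sq_nonneg (‖F u‖ - L * ‖z n - u‖)]
    have hl0 : 0 ≤ lam n := hc.le.trans h3
    have h12 := mul_le_mul_of_nonneg_left h7 hl0
    have h13 : C * (α n * ‖F (z n)‖ ^ 2)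
        ≤ 2 * C * ‖F u‖ ^ 2 + c * γ / 2 * s n := by
      calc C * (α n * ‖F (z n)‖ ^ 2)
          ≤ C * (α n * (2 * ‖F u‖ ^ 2 + 2 * (L : ℝ) ^ 2 * s n)) := by gcongr
        _ = 2 * C * ‖F u‖ ^ 2 * α n + 2 * C * (L : ℝ) ^ 2 * α n * s n := by ring
        _ ≤ 2 * C * ‖F u‖ ^ 2 * 1 + c * γ / 2 * s n :=
            add_le_add (mul_le_mul_of_nonneg_left h6.le (by positivity))
              (mul_le_mul_of_nonneg_right h2 (hs0 n))
        _ = _ := by ring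
    have h14 : lam n * (‖F u‖ ^ 2 / γ) ≤ τ₁ * (‖F u‖ ^ 2 / γ) := by gcongr
    have h15 : c * γ * s n ≤ lam n * γ * s n :=
      mul_le_mul_of_nonneg_right (mul_le_mul_of_nonneg_right h3 hγ.le) (hs0 n)
    simp only [hh, hD]
    linarith
  obtain ⟨R, hR⟩ := SplitInclusion.exists_bound_of_descent (s := s) (α := α) (h := h)
    (κ := c * γ / 2) (D := D) (N := N) hs0 (by positivity) hD0
    (fun n hn => ⟨(hα n (hN n hn).1).1.le, (hα n (hN n hn).1).2.le⟩)
    (fun n hn => (hrec n (hN n hn).1).trans (by linarith [hη0 n])) (fun n hn => (hN n hn).2)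
  have hbdd : ∀ n ≥ N, ‖z n - u‖ ≤ √R := fun n hn => Real.le_sqrt_of_sq_le (hR n hn)
  have hsum : Tendsto (fun N => ∑ n ∈ Finset.range N, α n) atTop atTop := by
    rw [← tendsto_add_atTop_iff_nat 1]
    refine (tendsto_atTop_add_const_left _ (α 0) hα_sum).congr fun n => ?_
    rw [Finset.range_eq_Ico, Finset.sum_eq_sum_Ico_succ_bot (Nat.succ_pos n)]
    rfl
  have hlim : Tendsto s atTop (𝓝 0) := by
    refine SplitInclusion.tendsto_zero_of_descent hs0
      ((eventually_ge_atTop 1).mono fun n hn => (hα n hn).1.le) hα_lim hsum hη0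
      ((eventually_ge_atTop N).mono fun n hn => (hN n hn).2.trans
        (sub_le_self D (mul_nonneg (by positivity) (hs0 n))))
      ((eventually_ge_atTop 1).mono hrec) fun U hU ε hε hUs hUη => ?_
    have hUN : ∀ᶠ n in (U : Filter ℕ), N ≤ n := hU (eventually_ge_atTop N)
    have hUz : ∀ᶠ n in (U : Filter ℕ), ‖z n‖ ≤ √R + ‖u‖ := hUN.mono fun n hn => by
      linarith [hbdd n hn, norm_le_norm_sub_add (z n) u]
    have hUF : ∀ᶠ n in (U : Filter ℕ), ‖F (z n)‖ ≤ ‖F u‖ + L * √R := hUN.mono fun n hn =>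
      (hFnorm n).trans (by gcongr; exact hbdd n hn)
    obtain ⟨w, hw⟩ := SplitInclusion.exists_weakTendsto U hUz
    have hwΩ := SplitInclusion.mem_solutionSet_of_weakTendsto hB₁ hB₂ hf₁ hf₂ hw hUz hUF hc
      (hUN.mono fun n hn => ⟨(hlam' n (hN n hn).1).1, (hlam' n (hN n hn).1).2.2.2.2⟩)
      (hα_lim.mono_left hU) (by simpa [hη, hk0.ne'] using hUη.const_mul k⁻¹)
    have h1 : Tendsto (fun n => inner ℝ (F u) (z n - u)) U (𝓝 (inner ℝ (F u) (w - u))) := by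
      have := (hw (F u)).sub_const (inner ℝ u (F u))
      simpa only [inner_sub_right, real_inner_comm] using this
    have h2 : ∀ᶠ n in (U : Filter ℕ), -(γ * ε / 2) < inner ℝ (F u) (z n - u) :=
      h1.eventually_const_lt (by have := hu.2 w hwΩ; have := mul_pos hγ hε; linarith)
    have h3 : Tendsto (fun n => C * (α n * (‖F u‖ + L * √R) ^ 2)) U (𝓝 0) := by
      simpa using ((hα_lim.mono_left hU).mul_const ((‖F u‖ + L * √R) ^ 2)).const_mul C
    refine ⟨c * γ * ε / 2, by positivity, ?_⟩
    filter_upwards [hUs, hUN, hUF, h2, h3.eventually_le_const (by positivity : 0 < c * γ * ε / 2)]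
      with n h4 h5 h6 h7 h8
    have hn1 := (hN n h5).1
    have h9 : γ * ε / 2 ≤ inner ℝ (F (z n)) (z n - u) := by
      linarith [hmono n, mul_le_mul_of_nonneg_left h4 hγ.le]
    have h10 : c * (γ * ε / 2) ≤ lam n * inner ℝ (F (z n)) (z n - u) :=
      mul_le_mul (hlam' n hn1).1 h9 (by positivity) (hc.le.trans (hlam' n hn1).1)
    have h11 : C * (α n * ‖F (z n)‖ ^ 2) ≤ C * (α n * (‖F u‖ + L * √R) ^ 2) := by
      have := (hα n hn1).1
      gcongr
    simp only [hh]
    linarith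
  rw [tendsto_iff_norm_sub_tendsto_zero]
  simpa [hs, Real.sqrt_sq (norm_nonneg _)] using hlim.sqrt
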